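/- Let $\omega=\exp(2\pi i/3)$, $\beta=\omega-1$ and $\mathcal D=\{0,\pm1,\pm\omega,\pm\omega^2\}$. A representation of $x\in\mathbb Z[\omega]$ is a sequence $(d_k)_{k\ge 0}$ of digits $d_k\in\mathcal D$, only finitely many of them non-zero, with $x=\sum_{k\ge0}d_k\beta^k$ (so digit strings that differ only in leading zeros are the same representation). It is optimal if it has the least number of non-zero digits among all representations of $x$. It is a $2$-NAF if of any two consecutive digits at most one is non-zero. Put $s_N=\lfloor (6\cdot 2^N+1)/7\rfloor$. Every $x\in\mathbb Z[\omega]$ has exactly one $2$-NAF, and moreover: (i) If the $2$-NAF of $x\in\mathbb Z[\omega]$ has $N$ non-zero digits, then $x$ has at most $s_N$ optimal representations. (ii) For every $N\ge 4$ there are exactly $12$ Eisenstein integers $x\in\mathbb Z[\omega]\setminus\beta\mathbb Z[\omega]$ whose $2$-NAF has $N$ non-zero digits and which have exactly $s_N$ optimal representations. -/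

import Mathlib

namespace EisensteinNAF

noncomputable section

/-- The primitive third root of unity `ω = exp(2πi/3)`. -/
def ω : ℂ := Complex.exp (2 * Real.pi * Complex.I / 3)

/-- The ring `ℤ[ω]` of Eisenstein integers, as a subring of `ℂ`. -/
def eisensteinIntegers : Subalgebra ℤ ℂ := Algebra.adjoin ℤ {ω}

/-- The base `β = ω - 1`. -/
def β : ℂ := ω - 1

/-- The digit set `{0, ±1, ±ω, ±ω²}`. -/
def digits : Set ℂ := {0, 1, -1, ω, -ω, ω ^ 2, -ω ^ 2}

/-- `d` is a representation of `x`: a digit string `⋯ 0 0 d_n ⋯ d_1 d_0`, taken up to leading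
zeros (that is, as a finitely supported sequence), with all `d_k` in the digit set and
`∑ d_k β^k = x`. -/
def IsRepresentation (x : ℂ) (d : ℕ →₀ ℂ) : Prop :=
  (∀ k, d k ∈ digits) ∧ d.sum (fun k a => a * β ^ k) = x

/-- The Hamming weight: the number of non-zero digits. -/
def weight (d : ℕ →₀ ℂ) : ℕ := d.support.card

/-- `d` is a width-`W` non-adjacent form (`W`-NAF) of `x`: a representation of `x` in which among
any `W` consecutive digits at most one is non-zero. -/
def IsNAF (W : ℕ) (x : ℂ) (d : ℕ →₀ ℂ) : Prop :=
  IsRepresentation x d ∧ ∀ i j, i < j → j < i + W → d i = 0 ∨ d j = 0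

/-- The optimal representations of `x`: those with the fewest non-zero digits among all
representations of `x`. -/
def optimalRepresentations (x : ℂ) : Set (ℕ →₀ ℂ) :=
  {d | IsRepresentation x d ∧ ∀ d', IsRepresentation x d' → weight d ≤ weight d'}

/-- `s_N = ⌊(6 · 2^N + 1) / 7⌋` (division of natural numbers rounds down). -/
def s (N : ℕ) : ℕ := (6 * 2 ^ N + 1) / 7

end

end EisensteinNAF

/-!
# Counting optimal representations of Eisenstein integers

If `u` is a unit and `x = u + β y`, the possible lowest digits of `x` are the units `u`, `ωu`, `ω²u`
of its residue class modulo `β`, so the representations of `x` of weight `m` are the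
representations of weight `m - 1` of `y`, `y - u` and `y + ω² u` together
(`repCount_add`), while `β y` and `y` have equally many (`repCount_b_mul`).

Let `x` have a 2-NAF with `n` non-zero digits, the lowest of them `u`. Unfolding the recursion
twice shows that the only carries that matter are `0` and the six units: the number `f` of
representations of `x` of weight `n` and the numbers of representations of `x + v` of weight
`n - 1`, for units `v`, are determined by the same data for the 2-NAF with its lowest digit removed
(`HasState.append`), and no representation is shorter. So the 2-NAF has minimal weight and `f` counts
the optimal representations. Only four of the six neighbours `x + v` can contribute, and skipping a
further zero digit makes all of them vanish (`HasState.shift`), so the count is computed by an automaton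
with five counters whose transitions depend on the quotient of consecutive non-zero digits.

The bound `f ≤ s n` follows from linear inequalities between the counters that every transition
preserves (`State.Bound.move`). The same inequalities show that `f = s (n + 1)` forces `f = s n` one
digit earlier and forces the quotient of the last two digits: it is `-ω` for `n ≡ 2` modulo 3 and `ω`
otherwise, except that both are possible for `n = 3`. So there are `6` extremal numbers outside
`β ℤ[ω]` for `n ≤ 3`, `n ≥ 1`, one for each leading digit, and `12` from `n = 4` on (`card_extremal`).
-/

namespace EisensteinNAF

/-! ### Exact arithmetic in the Eisenstein integers -/

/-- The Eisenstein integers in coordinates: `⟨p, q⟩` stands for `p + q ω`, with `ω² = -1 - ω`. All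
digit arithmetic takes place here, where equality is decidable; `toComplex` is the embedding
into `ℂ`. -/
abbrev Eis : Type := QuadraticAlgebra ℤ (-1) (-1)

namespace Eis

open QuadraticAlgebra

/-- The cube root of unity `ω` in `Eis`. -/
def w : Eis := ⟨0, 1⟩

/-- The base `β = ω - 1` in `Eis`. -/
def b : Eis := ⟨-1, 1⟩

/-- The six units `±1, ±ω, ±ω²`, which are the non-zero digits. -/
def units : Finset Eis := {⟨1, 0⟩, ⟨-1, 0⟩, ⟨0, 1⟩, ⟨0, -1⟩, ⟨-1, -1⟩, ⟨1, 1⟩}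

@[simp] theorem re_w : w.re = 0 := rfl
@[simp] theorem im_w : w.im = 1 := rfl
@[simp] theorem re_b : b.re = -1 := rfl
@[simp] theorem im_b : b.im = 1 := rfl

theorem w_sq : w ^ 2 = -1 - w := by decide

theorem b_eq : b = w - 1 := by decide

theorem w_mem_units : w ∈ units := by decide

theorem one_mem_units : (1 : Eis) ∈ units := by decide

theorem neg_mem_units : ∀ u ∈ units, -u ∈ units := by decide

theorem mul_mem_units : ∀ u ∈ units, ∀ v ∈ units, u * v ∈ units := by decide

theorem w_mul_mem_units {u : Eis} (hu : u ∈ units) : w * u ∈ units :=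
  mul_mem_units _ w_mem_units _ hu

theorem w_sq_mul_mem_units {u : Eis} (hu : u ∈ units) : w ^ 2 * u ∈ units :=
  mul_mem_units _ (by decide) _ hu

theorem b_mul_injective : Function.Injective (b * · : Eis → Eis) := by
  intro x y h
  have h1 := congrArg re h
  have h2 := congrArg im h
  simp only [re_mul, im_mul, re_b, im_b] at h1 h2
  ext <;> omega

theorem b_sq_mul_injective : Function.Injective (b ^ 2 * · : Eis → Eis) := by
  intro x y h
  simp only [pow_two, mul_assoc] at h
  exact b_mul_injective (b_mul_injective h)

theorem b_dvd_iff {x : Eis} : b ∣ x ↔ (3 : ℤ) ∣ x.re + x.im := by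
  constructor
  · rintro ⟨y, rfl⟩
    simp only [re_mul, im_mul, re_b, im_b]
    omega
  · rintro ⟨k, hk⟩
    refine ⟨⟨-x.re + k, -k⟩, ?_⟩
    ext
    · simp
    · simp; omega

theorem b_sq_dvd_iff {x : Eis} : b ^ 2 ∣ x ↔ (3 : ℤ) ∣ x.re ∧ (3 : ℤ) ∣ x.im := by
  have hb : b ^ 2 = ⟨0, -3⟩ := by decide
  rw [hb]
  constructor
  · rintro ⟨y, rfl⟩
    simp only [re_mul, im_mul]
    omega
  · rintro ⟨⟨k, hk⟩, ⟨l, hl⟩⟩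
    refine ⟨⟨k - l, k⟩, ?_⟩
    ext
    · simp; omega
    · simp; omega

instance (x : Eis) : Decidable (b ∣ x) := decidable_of_iff _ b_dvd_iff.symm

instance (x : Eis) : Decidable (b ^ 2 ∣ x) := decidable_of_iff _ b_sq_dvd_iff.symm

theorem not_b_dvd_of_mem_units : ∀ u ∈ units, ¬ b ∣ u := by decide

theorem not_b_dvd_add {u : Eis} (hu : u ∈ units) (y : Eis) : ¬ b ∣ u + b * y := fun h =>
  not_b_dvd_of_mem_units u hu ((dvd_add_left (dvd_mul_right b y)).1 h)

theorem eq_or_of_b_dvd_sub :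
    ∀ u ∈ units, ∀ v ∈ units, b ∣ u - v → u = v ∨ u = w * v ∨ u = w ^ 2 * v := by decide

theorem eq_of_b_sq_dvd_sub : ∀ u ∈ units, ∀ v ∈ units, b ^ 2 ∣ u - v → u = v := by decide

theorem ne_w_mul : ∀ u ∈ units, u ≠ w * u ∧ u ≠ w ^ 2 * u ∧ w * u ≠ w ^ 2 * u := by decide

/-- Every unit differs from a given unit `u` by one of the six factors `±1, ±ω, ±ω²`. -/
theorem eq_of_mem_units : ∀ u ∈ units, ∀ v ∈ units,
    v = u ∨ v = w * u ∨ v = w ^ 2 * u ∨ v = -u ∨ v = -(w * u) ∨ v = -(w ^ 2 * u) := by decide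

/-- The lowest non-zero digit of a 2-NAF is determined by the residue class modulo `β²`, and the
rest of the expansion by cancellation. -/
theorem digit_unique {u v y z : Eis} (hu : u ∈ units) (hv : v ∈ units)
    (h : u + b ^ 2 * y = v + b ^ 2 * z) : u = v ∧ y = z := by
  have huv : u = v := eq_of_b_sq_dvd_sub u hu v hv ⟨z - y, by linear_combination h⟩
  subst huv
  exact ⟨rfl, b_sq_mul_injective (add_left_cancel h)⟩

/-- A hexagonal norm on `Eis`, invariant under units, which decreases when a digit is split off. -/
def size (x : Eis) : ℕ := x.re.natAbs + x.im.natAbs + (x.re - x.im).natAbs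

/-- Induction along the digits of the 2-NAF, from the most significant one down. The units
represent the non-zero classes modulo `β²` outside `β ℤ[ω]`. -/
theorem naf_induction {P : Eis → Prop} (zero : P 0) (shift : ∀ y, P y → P (b * y))
    (digit : ∀ u ∈ units, ∀ y, P y → P (u + b ^ 2 * y)) (x : Eis) : P x := by
  suffices H : ∀ n x, size x = n → P x from H _ x rfl
  intro n
  induction n using Nat.strong_induction_on with
  | _ n ih =>
    intro x hx
    by_cases h0 : x = 0
    · exact h0 ▸ zero
    have h0' : ¬ (x.re = 0 ∧ x.im = 0) := fun h => h0 (QuadraticAlgebra.ext h.1 h.2)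
    by_cases hb : b ∣ x
    · obtain ⟨y, rfl⟩ := hb
      refine shift y (ih (size y) ?_ y rfl)
      subst hx
      simp only [size, re_mul, im_mul, re_b, im_b] at h0' ⊢
      omega
    · have key : ∃ u ∈ units, b ^ 2 ∣ x - u := by
        have hb' : ¬ (3 : ℤ) ∣ x.re + x.im := fun h => hb (b_dvd_iff.2 h)
        simp only [b_sq_dvd_iff, units, Finset.mem_insert, Finset.mem_singleton,
          exists_eq_or_imp, exists_eq_left, re_sub, im_sub]
        omega
      obtain ⟨u, hu, y, hy⟩ := key
      have hxy : x = u + b ^ 2 * y := by linear_combination hy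
      subst hxy
      refine digit u hu y (ih (size y) ?_ y rfl)
      subst hx
      have hb2 : b ^ 2 = ⟨0, -3⟩ := by decide
      simp only [units, Finset.mem_insert, Finset.mem_singleton] at hu
      rw [hb2]
      rcases hu with rfl | rfl | rfl | rfl | rfl | rfl <;>
        simp only [size, re_mul, im_mul, re_add, im_add] <;> omega

/-! ### Digit strings: prepending and removing the lowest digit -/

/-- The digit string with lowest digit `a`, followed by the digits of `d`. -/
noncomputable def cons (a : Eis) (d : ℕ →₀ Eis) : ℕ →₀ Eis :=
  Finsupp.single 0 a + d.mapDomain Nat.succ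

/-- The digit string with its lowest digit removed. -/
noncomputable def tail (d : ℕ →₀ Eis) : ℕ →₀ Eis :=
  d.comapDomain Nat.succ Nat.succ_injective.injOn

@[simp] theorem cons_zero (a : Eis) (d : ℕ →₀ Eis) : cons a d 0 = a := by
  rw [cons, Finsupp.add_apply, Finsupp.mapDomain_of_notMem_range _ _ (by simp)]
  simp

@[simp] theorem cons_succ (a : Eis) (d : ℕ →₀ Eis) (k : ℕ) : cons a d (k + 1) = d k := by
  rw [cons, Finsupp.add_apply, Finsupp.mapDomain_apply Nat.succ_injective d k]
  simp

@[simp] theorem tail_apply (d : ℕ →₀ Eis) (k : ℕ) : tail d k = d (k + 1) := rfl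

theorem cons_tail (d : ℕ →₀ Eis) : cons (d 0) (tail d) = d := by
  ext1 k
  cases k <;> simp

theorem cons_injective (a : Eis) : Function.Injective (cons a) := by
  intro d e h
  ext1 k
  simpa using DFunLike.congr_fun h (k + 1)

/-- The number `∑ d_k β^k` written by a digit string. -/
noncomputable def value (d : ℕ →₀ Eis) : Eis := d.sum fun k a => a * b ^ k

@[simp] theorem value_zero : value 0 = 0 := Finsupp.sum_zero_index

theorem value_cons (a : Eis) (d : ℕ →₀ Eis) : value (cons a d) = a + b * value d := by
  rw [value, cons, Finsupp.sum_add_index' (by simp) (by intros; ring),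
    Finsupp.sum_single_index (by simp),
    Finsupp.sum_mapDomain_index (by simp) (by intros; ring), value, Finsupp.mul_sum]
  simp only [pow_zero, mul_one, Nat.succ_eq_add_one, pow_succ]
  congr 1
  exact Finsupp.sum_congr fun k _ => by ring

theorem support_cons (a : Eis) (d : ℕ →₀ Eis) :
    (cons a d).support = if a = 0 then d.support.map ⟨Nat.succ, Nat.succ_injective⟩
      else insert 0 (d.support.map ⟨Nat.succ, Nat.succ_injective⟩) := by
  ext k
  cases k <;> split_ifs with h <;> simp [h]

theorem card_support_cons_zero (d : ℕ →₀ Eis) :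
    (cons 0 d).support.card = d.support.card := by
  simp [support_cons]

theorem card_support_cons {a : Eis} (ha : a ≠ 0) (d : ℕ →₀ Eis) :
    (cons a d).support.card = d.support.card + 1 := by
  rw [support_cons, if_neg ha, Finset.card_insert_of_notMem (by simp), Finset.card_map]

/-! ### Counting the representations of a given weight -/

/-- `d` is a digit string for `x` over the digits `0, ±1, ±ω, ±ω²`. -/
def IsRep (x : Eis) (d : ℕ →₀ Eis) : Prop :=
  (∀ k, d k = 0 ∨ d k ∈ units) ∧ value d = x

theorem isRep_cons_iff {x a : Eis} {d : ℕ →₀ Eis} :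
    IsRep x (cons a d) ↔ (a = 0 ∨ a ∈ units) ∧ (∀ k, d k = 0 ∨ d k ∈ units) ∧
      a + b * value d = x := by
  rw [IsRep, value_cons, ← and_assoc]
  refine and_congr_left fun _ => ⟨fun h => ⟨by simpa using h 0, fun k => by simpa using h (k + 1)⟩,
    fun h k => ?_⟩
  cases k
  · simpa using h.1
  · simpa using h.2 _

/-- The representations of `x` of weight `m`. The weight ranges over `ℤ`, so that lowering it by
one needs no side condition. -/
def repSet (x : Eis) (m : ℤ) : Set (ℕ →₀ Eis) := {d | IsRep x d ∧ (d.support.card : ℤ) = m}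

/-- The number of representations of `x` of weight `m`; it can be infinite when `m` exceeds the
minimal weight. -/
noncomputable def repCount (x : Eis) (m : ℤ) : ℕ∞ := (repSet x m).encard

theorem repCount_of_neg (x : Eis) {m : ℤ} (hm : m < 0) : repCount x m = 0 := by
  rw [repCount, Set.encard_eq_zero, Set.eq_empty_iff_forall_notMem]
  rintro d ⟨-, hd⟩
  omega

theorem repCount_zero_zero : repCount 0 0 = 1 := by
  rw [repCount, Set.encard_eq_one]
  refine ⟨0, Set.ext fun d => ⟨fun ⟨_, h⟩ => ?_, ?_⟩⟩
  · simpa using h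
  · rintro rfl
    exact ⟨⟨by simp, by simp⟩, by simp⟩

theorem ne_zero_of_mem_units : ∀ u ∈ units, u ≠ 0 := by decide

theorem cons_zero_mem_repSet {y : Eis} {m : ℤ} {d : ℕ →₀ Eis} :
    cons 0 d ∈ repSet (b * y) m ↔ d ∈ repSet y m := by
  rw [repSet, repSet, Set.mem_ofPred_eq, Set.mem_ofPred_eq, card_support_cons_zero, isRep_cons_iff,
    IsRep, zero_add, b_mul_injective.eq_iff (a := value d)]
  simp

theorem cons_mem_repSet {u y : Eis} {m : ℤ} {d : ℕ →₀ Eis} (hu : u ∈ units) :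
    cons u d ∈ repSet (u + b * y) m ↔ d ∈ repSet y (m - 1) := by
  rw [repSet, repSet, Set.mem_ofPred_eq, Set.mem_ofPred_eq,
    card_support_cons (ne_zero_of_mem_units u hu), isRep_cons_iff, IsRep, add_right_inj,
    b_mul_injective.eq_iff (a := value d), and_iff_right (Or.inr hu)]
  refine and_congr_right fun _ => ?_
  omega

theorem repCount_b_mul (y : Eis) (m : ℤ) : repCount (b * y) m = repCount y m := by
  have h : repSet (b * y) m = cons 0 '' repSet y m := by
    ext d
    constructor
    · intro hd
      have h0 : d 0 = 0 := by
        have h1 := hd.1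
        rw [← cons_tail d, isRep_cons_iff] at h1
        refine h1.1.resolve_right fun hu => not_b_dvd_add hu (value (tail d)) ?_
        exact ⟨y, h1.2.2⟩
      rw [← cons_tail d, h0] at hd ⊢
      exact ⟨_, cons_zero_mem_repSet.1 hd, rfl⟩
    · rintro ⟨d, hd, rfl⟩
      exact cons_zero_mem_repSet.2 hd
  rw [repCount, h, (cons_injective 0).encard_image, repCount]

theorem add_eq_w_mul_add (u y : Eis) : u + b * y = w * u + b * (y - u) := by
  rw [b_eq]; ring

theorem add_eq_w_sq_mul_add (u y : Eis) : u + b * y = w ^ 2 * u + b * (y + w ^ 2 * u) := by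
  rw [b_eq]; linear_combination (1 - w) * u * w_sq

/-- The recursion behind all counts: a number outside `β ℤ[ω]` has three possible lowest digits,
the units `u`, `ωu`, `ω²u` of its residue class modulo `β`. -/
theorem repCount_add {u : Eis} (hu : u ∈ units) (y : Eis) (m : ℤ) :
    repCount (u + b * y) m =
      repCount y (m - 1) + repCount (y - u) (m - 1) + repCount (y + w ^ 2 * u) (m - 1) := by
  have h1 := w_mul_mem_units hu
  have h2 := w_sq_mul_mem_units hu
  have h : repSet (u + b * y) m = cons u '' repSet y (m - 1) ∪
      cons (w * u) '' repSet (y - u) (m - 1) ∪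
      cons (w ^ 2 * u) '' repSet (y + w ^ 2 * u) (m - 1) := by
    ext d
    constructor
    · intro hd
      have hr := hd.1
      rw [← cons_tail d, isRep_cons_iff] at hr
      have hd0 : d 0 ∈ units := hr.1.resolve_left fun h0 => by
        rw [h0, zero_add] at hr
        exact not_b_dvd_add hu y ⟨_, hr.2.2.symm⟩
      have hdvd : b ∣ d 0 - u := ⟨y - value (tail d), by linear_combination hr.2.2⟩
      rw [← cons_tail d] at hd ⊢
      rcases eq_or_of_b_dvd_sub _ hd0 _ hu hdvd with h0 | h0 | h0
      · rw [h0] at hd ⊢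
        exact Or.inl (Or.inl ⟨_, (cons_mem_repSet hu).1 hd, rfl⟩)
      · rw [h0, add_eq_w_mul_add] at hd
        rw [h0]
        exact Or.inl (Or.inr ⟨_, (cons_mem_repSet h1).1 hd, rfl⟩)
      · rw [h0, add_eq_w_sq_mul_add] at hd
        rw [h0]
        exact Or.inr ⟨_, (cons_mem_repSet h2).1 hd, rfl⟩
    · rintro ((⟨d, hd, rfl⟩ | ⟨d, hd, rfl⟩) | ⟨d, hd, rfl⟩)
      · exact (cons_mem_repSet hu).2 hd
      · rw [add_eq_w_mul_add]
        exact (cons_mem_repSet h1).2 hd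
      · rw [add_eq_w_sq_mul_add]
        exact (cons_mem_repSet h2).2 hd
  have hdisj : ∀ {a a' : Eis} {S T : Set (ℕ →₀ Eis)}, a ≠ a' →
      Disjoint (cons a '' S) (cons a' '' T) := by
    intro a a' S T hne
    rw [Set.disjoint_left]
    rintro _ ⟨d, -, rfl⟩ ⟨e, -, he⟩
    exact hne (by simpa using (DFunLike.congr_fun he 0).symm)
  obtain ⟨n1, n2, n3⟩ := ne_w_mul u hu
  rw [repCount, h, Set.encard_union_eq (Set.disjoint_union_left.2 ⟨hdisj n2, hdisj n3⟩),
    Set.encard_union_eq (hdisj n1), (cons_injective _).encard_image,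
    (cons_injective _).encard_image, (cons_injective _).encard_image]
  rfl

/-! ### The counting automaton -/

/-- The counts attached to a number `x` of weight `n` with lowest non-zero digit `u`: `f` is the
number of representations of `x` of weight `n`, and `p`, `q`, `r`, `t` are the numbers of
representations of weight `n - 1` of `x - u`, `x - ωu`, `x - ω²u` and `x + u`. -/
@[ext]
structure State where
  /-- the count for `x` itself -/
  f : ℕ
  /-- the count for `x - u` -/
  p : ℕ
  /-- the count for `x - ωu` -/
  q : ℕ
  /-- the count for `x - ω²u` -/
  r : ℕ
  /-- the count for `x + u` -/
  t : ℕ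

/-- `s` records the counts of `x`. Besides the values of the fields this says that no smaller
weights occur, and that the remaining neighbours `x + ωu`, `x + ω²u` have no representations of
weight `n - 1`. -/
structure HasState (x : Eis) (n : ℕ) (u : Eis) (s : State) : Prop where
  mem_units : u ∈ units
  below : ∀ m : ℤ, m < n → repCount x m = 0
  below_unit : ∀ v ∈ units, ∀ m : ℤ, m < n - 1 → repCount (x + v) m = 0
  count : repCount x n = s.f
  count_p : repCount (x - u) (n - 1) = s.p
  count_q : repCount (x - w * u) (n - 1) = s.q
  count_r : repCount (x - w ^ 2 * u) (n - 1) = s.r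
  count_t : repCount (x + u) (n - 1) = s.t
  count_w : repCount (x + w * u) (n - 1) = 0
  count_w_sq : repCount (x + w ^ 2 * u) (n - 1) = 0

/-- The quotient of two consecutive non-zero digits: one of the six units. -/
inductive Turn
  | one | om | om2 | negOne | negOm | negOm2

/-- The unit named by a turn. -/
def Turn.factor : Turn → Eis
  | one => 1
  | om => w
  | om2 => w ^ 2
  | negOne => -1
  | negOm => -w
  | negOm2 => -w ^ 2

/-- The transition: with `α`, `γ`, `δ` the counts of `x + v`, `x - ω²v` and `x + ωv`, these are
the counts of `v + β² x`. -/
def State.step (s : State) (α γ δ : ℕ) : State :=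
  ⟨s.f + α + 2 * γ + δ, s.f, α + γ, γ + δ, γ⟩

/-- The transition when a digit is appended whose quotient by the previous one is the given turn. -/
def State.move (s : State) : Turn → State
  | .one => s.step s.t s.r 0
  | .om => s.step 0 s.p 0
  | .om2 => s.step 0 s.q s.t
  | .negOne => s.step s.p 0 s.q
  | .negOm => s.step s.q s.t s.r
  | .negOm2 => s.step s.r 0 s.p

/-- The state after a shift by `β`: no neighbour has weight `n - 1` any more. -/
def State.reset (s : State) : State := ⟨s.f, 0, 0, 0, 0⟩

theorem exists_turn {u v : Eis} (hu : u ∈ units) (hv : v ∈ units) :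
    ∃ τ : Turn, v = τ.factor * u := by
  rcases eq_of_mem_units u hu v hv with h | h | h | h | h | h
  · exact ⟨.one, by simp [h, Turn.factor]⟩
  · exact ⟨.om, by simp [h, Turn.factor]⟩
  · exact ⟨.om2, by simp [h, Turn.factor]⟩
  · exact ⟨.negOne, by simp [h, Turn.factor]⟩
  · exact ⟨.negOm, by simp [h, Turn.factor]⟩
  · exact ⟨.negOm2, by simp [h, Turn.factor]⟩

theorem factor_mem_units (τ : Turn) : τ.factor ∈ units := by
  cases τ <;> decide

theorem hasState_zero {u : Eis} (hu : u ∈ units) : HasState 0 0 u ⟨1, 0, 0, 0, 0⟩ := by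
  refine ⟨hu, fun m hm => repCount_of_neg _ hm, fun v _ m hm => repCount_of_neg _ ?_, ?_, ?_, ?_, ?_,
    ?_, ?_, ?_⟩
  · push_cast at hm; omega
  · exact repCount_zero_zero
  all_goals exact repCount_of_neg _ (by simp)

/-- Adding a unit below the digits of `z` does not lower the weight: the new digit costs one, and the
carry it sends to `z` saves at most one. -/
theorem HasState.repCount_b_mul_add_eq_zero {z u : Eis} {n : ℕ} {s : State}
    (h : HasState z n u s) {v : Eis} (hv : v ∈ units) {m : ℤ} (hm : m < n) :
    repCount (b * z + v) m = 0 := by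
  rw [add_comm, repCount_add hv, h.below _ (by omega), sub_eq_add_neg,
    h.below_unit _ (neg_mem_units v hv) _ (by omega),
    h.below_unit _ (w_sq_mul_mem_units hv) _ (by omega)]
  simp

theorem HasState.shift {z u v : Eis} {n : ℕ} {s : State} (h : HasState z n u s)
    (hv : v ∈ units) : HasState (b * z) n v s.reset := by
  have key : ∀ c ∈ units, repCount (b * z + c) (n - 1) = 0 := fun c hc =>
    h.repCount_b_mul_add_eq_zero hc (by omega)
  refine ⟨hv, fun m hm => ?_, fun c hc m hm => h.repCount_b_mul_add_eq_zero hc (by omega),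
    ?_, ?_, ?_, ?_, key _ hv, key _ (w_mul_mem_units hv), key _ (w_sq_mul_mem_units hv)⟩
  · rw [repCount_b_mul, h.below m hm]
  · rw [repCount_b_mul, h.count]; rfl
  · rw [sub_eq_add_neg, key _ (neg_mem_units _ hv)]; rfl
  · rw [sub_eq_add_neg, key _ (neg_mem_units _ (w_mul_mem_units hv))]; rfl
  · rw [sub_eq_add_neg, key _ (neg_mem_units _ (w_sq_mul_mem_units hv))]; rfl

/-- Appending a digit `v`. All six neighbours of `v + β² z` lie, up to powers of `β`, within one
unit of `z`, or have no short representations. -/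
theorem HasState.append {z u v : Eis} {n : ℕ} {s : State} (h : HasState z n u s)
    (hv : v ∈ units) {α γ δ : ℕ} (hα : repCount (z + v) (n - 1) = α)
    (hγ : repCount (z - w ^ 2 * v) (n - 1) = γ) (hδ : repCount (z + w * v) (n - 1) = δ) :
    HasState (v + b ^ 2 * z) (n + 1) v (s.step α γ δ) := by
  have hv1 := w_mul_mem_units hv
  have hv2 := w_sq_mul_mem_units hv
  have hb := fun {c : Eis} (hc : c ∈ units) {m : ℤ} (hm : m < n) =>
    h.repCount_b_mul_add_eq_zero hc hm
  -- the lowest digit `c` is not absorbed by `β² z`, so all weights are at least `n + 1`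
  have digit : ∀ c ∈ units, ∀ m : ℤ, m < n + 1 → repCount (c + b ^ 2 * z) m = 0 := by
    intro c hc m hm
    rw [pow_two, mul_assoc, repCount_add hc, repCount_b_mul, h.below _ (by omega), sub_eq_add_neg,
      hb (neg_mem_units c hc) (by omega), hb (w_sq_mul_mem_units hc) (by omega)]
    simp
  have lo1 : ∀ m : ℤ, m = n → repCount (b * z - v) m = (α + γ : ℕ) := by
    rintro m rfl
    rw [show b * z - v = -v + b * z by ring, repCount_add (neg_mem_units v hv),
      h.below _ (by omega), show z - -v = z + v by ring,
      show z + w ^ 2 * -v = z - w ^ 2 * v by ring, hα, hγ]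
    simp
  have lo2 : ∀ m : ℤ, m = n → repCount (b * z + w ^ 2 * v) m = (γ + δ : ℕ) := by
    rintro m rfl
    rw [show b * z + w ^ 2 * v = w ^ 2 * v + b * z by ring, repCount_add hv2,
      h.below _ (by omega), show z + w ^ 2 * (w ^ 2 * v) = z + w * v by
        linear_combination (w ^ 2 - w) * v * w_sq, hδ, hγ]
    simp
  have eq_q : v + b ^ 2 * z - w * v = b * (b * z - v) := by rw [b_eq]; ring
  have eq_r : v + b ^ 2 * z - w ^ 2 * v = b * (b * z + w ^ 2 * v) := by
    rw [b_eq]; linear_combination (1 - w) * v * w_sq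
  have double : ∀ m : ℤ, m < n + 1 →
      repCount (v + b ^ 2 * z + v) m = repCount (z - w ^ 2 * v) (m - 1) := by
    intro m hm
    have e1 : v + b ^ 2 * z + v = -v + b * (b * (z - w ^ 2 * v)) := by
      rw [b_eq]; linear_combination (w ^ 2 - 3 * w + 3) * v * w_sq
    have e2 : b * (z - w ^ 2 * v) - -v = b * z + w ^ 2 * v := by
      rw [b_eq]; linear_combination (1 - w) * v * w_sq
    have e3 : b * (z - w ^ 2 * v) + w ^ 2 * -v = b * z + -v := by
      rw [b_eq]; linear_combination (1 - w) * v * w_sq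
    rw [e1, repCount_add (neg_mem_units v hv), e2, e3, hb hv2 (by omega),
      hb (neg_mem_units v hv) (by omega), repCount_b_mul]
    simp
  have eq_w : v + b ^ 2 * z + w * v = -(w ^ 2 * v) + b ^ 2 * z := by
    linear_combination v * w_sq
  have eq_w2 : v + b ^ 2 * z + w ^ 2 * v = -(w * v) + b ^ 2 * z := by
    linear_combination v * w_sq
  have hn : ((n + 1 : ℕ) : ℤ) = n + 1 := by push_cast; ring
  have hn1 : ((n + 1 : ℕ) : ℤ) - 1 = n := by push_cast; ring
  refine ⟨hv, fun m hm => digit v hv m (by omega), fun c hc m hm => ?_, ?_, ?_, ?_, ?_, ?_, ?_, ?_⟩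
  · have hm' : m < n := by omega
    rcases eq_of_mem_units v hv c hc with rfl | rfl | rfl | rfl | rfl | rfl
    · rw [double m (by omega), sub_eq_add_neg,
        h.below_unit _ (neg_mem_units _ hv2) _ (by omega)]
    · rw [eq_w, digit _ (neg_mem_units _ hv2) m (by omega)]
    · rw [eq_w2, digit _ (neg_mem_units _ hv1) m (by omega)]
    · rw [show v + b ^ 2 * z + -v = b * (b * z) by ring, repCount_b_mul, repCount_b_mul,
        h.below m hm']
    · rw [← sub_eq_add_neg, eq_q, repCount_b_mul, sub_eq_add_neg,
        hb (neg_mem_units v hv) hm']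
    · rw [← sub_eq_add_neg, eq_r, repCount_b_mul, hb hv2 hm']
  · rw [hn, show v + b ^ 2 * z = v + b * (b * z) by ring, repCount_add hv, repCount_b_mul,
      lo1 _ (by ring), lo2 _ (by ring), show (n : ℤ) + 1 - 1 = n by ring, h.count]
    simp only [State.step]
    norm_cast
    ring
  · rw [hn1, show v + b ^ 2 * z - v = b * (b * z) by ring, repCount_b_mul, repCount_b_mul, h.count]
    rfl
  · rw [hn1, eq_q, repCount_b_mul, lo1 _ rfl]; rfl
  · rw [hn1, eq_r, repCount_b_mul, lo2 _ rfl]; rfl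
  · rw [hn1, double _ (by omega), hγ]; rfl
  · rw [hn1, eq_w, digit _ (neg_mem_units _ hv2) _ (by omega)]
  · rw [hn1, eq_w2, digit _ (neg_mem_units _ hv1) _ (by omega)]

theorem w_cube : w ^ 3 = 1 := by decide

theorem HasState.move {z u : Eis} {n : ℕ} {s : State} (h : HasState z n u s) (τ : Turn) :
    HasState (τ.factor * u + b ^ 2 * z) (n + 1) (τ.factor * u) (s.move τ) := by
  have hv := mul_mem_units _ (factor_mem_units τ) _ h.mem_units
  have h0 : (((0 : ℕ) : ℕ∞)) = 0 := rfl
  cases τ <;> refine h.append hv ?_ ?_ ?_ <;> simp only [Turn.factor, h0]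
  · convert h.count_t using 2; ring
  · convert h.count_r using 2; ring
  · convert h.count_w using 2; ring
  · exact h.count_w
  · convert h.count_p using 2; linear_combination -u * w_cube
  · convert h.count_w_sq using 2; ring
  · exact h.count_w_sq
  · convert h.count_q using 2; linear_combination -(w * u) * w_cube
  · convert h.count_t using 2; linear_combination u * w_cube
  · convert h.count_p using 2; ring
  · convert h.count_w_sq using 2; ring
  · convert h.count_q using 2; ring
  · convert h.count_q using 2; ring
  · convert h.count_t using 2; linear_combination u * w_cube
  · convert h.count_r using 2; ring
  · convert h.count_r using 2; ring
  · convert h.count_w using 2; linear_combination (w * u) * w_cube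
  · convert h.count_p using 2; linear_combination -u * w_cube

/-! ### Expansions -/

/-- `Expansion x n u s` says that the 2-NAF of `x` has `n` non-zero digits and that the automaton
reaches the state `s` on it. If `x` is not divisible by `β`, then `u` is its lowest digit; after a
shift the state no longer refers to a digit, and `u` is arbitrary. -/
inductive Expansion : Eis → ℕ → Eis → State → Prop
  | zero {u : Eis} : u ∈ units → Expansion 0 0 u ⟨1, 0, 0, 0, 0⟩
  | shift {z u v : Eis} {n : ℕ} {s : State} : Expansion z n u s → v ∈ units →
      Expansion (b * z) n v s.reset
  | digit {z u : Eis} {n : ℕ} {s : State} (τ : Turn) : Expansion z n u s →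
      Expansion (τ.factor * u + b ^ 2 * z) (n + 1) (τ.factor * u) (s.move τ)

theorem Expansion.hasState {x u : Eis} {n : ℕ} {s : State} (h : Expansion x n u s) :
    HasState x n u s := by
  induction h with
  | zero hu => exact hasState_zero hu
  | shift _ hv ih => exact ih.shift hv
  | digit τ _ ih => exact ih.move τ

theorem exists_expansion (x : Eis) : ∃ n u s, Expansion x n u s := by
  induction x using naf_induction with
  | zero => exact ⟨0, 1, _, .zero one_mem_units⟩
  | shift y ih =>
    obtain ⟨n, u, s, h⟩ := ih
    exact ⟨n, 1, _, h.shift one_mem_units⟩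
  | digit v hv y ih =>
    obtain ⟨n, u, s, h⟩ := ih
    obtain ⟨τ, rfl⟩ := exists_turn h.hasState.mem_units hv
    exact ⟨n + 1, _, _, h.digit τ⟩

end Eis

/-! ### The sequence `s` -/

/-- The closed form of `s` on residue classes modulo 3, for four consecutive terms, in terms of
`m = (8^⌊n/3⌋ - 1) / 7`. It turns linear inequalities between values of `s` into linear
inequalities in `m`. -/
theorem s_four_terms (n : ℕ) : ∃ m : ℕ, (3 ≤ n → 1 ≤ m) ∧
    ((n % 3 = 0 ∧ s n = 6 * m + 1 ∧ s (n + 1) = 12 * m + 1 ∧ s (n + 2) = 24 * m + 3 ∧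
        s (n + 3) = 48 * m + 7) ∨
      (n % 3 = 1 ∧ s n = 12 * m + 1 ∧ s (n + 1) = 24 * m + 3 ∧ s (n + 2) = 48 * m + 7 ∧
        s (n + 3) = 96 * m + 13) ∨
      (n % 3 = 2 ∧ s n = 24 * m + 3 ∧ s (n + 1) = 48 * m + 7 ∧ s (n + 2) = 96 * m + 13 ∧
        s (n + 3) = 192 * m + 27)) := by
  have key : ∀ k : ℕ, ∃ m : ℕ, 8 ^ k = 7 * m + 1 ∧ (1 ≤ k → 1 ≤ m) := by
    intro k
    induction k with
    | zero => exact ⟨0, by norm_num, by omega⟩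
    | succ k ih =>
      obtain ⟨m, hm, -⟩ := ih
      exact ⟨8 * m + 1, by rw [pow_succ, hm]; ring, by omega⟩
  obtain ⟨m, hm, hk⟩ := key (n / 3)
  have h2 : 2 ^ (3 * (n / 3)) = 7 * m + 1 := by rw [pow_mul, ← hm]; norm_num
  refine ⟨m, by omega, ?_⟩
  have hlt : n % 3 < 3 := Nat.mod_lt _ (by norm_num)
  have hn : n = 3 * (n / 3) + n % 3 := (Nat.div_add_mod n 3).symm
  simp only [s]
  obtain h | h | h : n % 3 = 0 ∨ n % 3 = 1 ∨ n % 3 = 2 := by omega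
  all_goals
    rw [h] at hn
    rw [hn]
    simp only [pow_add, h2]
    omega

theorem s_zero : s 0 = 1 := rfl
theorem s_one : s 1 = 1 := rfl
theorem s_two : s 2 = 3 := rfl
theorem s_three : s 3 = 7 := rfl

namespace Eis

open QuadraticAlgebra

/-! ### Bounds on the states -/

/-- Upper bounds for the fields of a state apart from `f`, after `n` non-zero digits. For `n ≤ 3`
they describe the largest state; from `n = 4` on they are linear bounds preserved by all
transitions. -/
def State.NeighbourBound : ℕ → State → Prop
  | 0, a => a.p = 0
  | 1, a => a.p ≤ 1 ∧ a.q = 0 ∧ a.r = 0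
  | 2, a => a.p ≤ 1 ∧ a.q ≤ 1 ∧ a.r ≤ 1
  | 3, a => a.p ≤ 3 ∧ a.q ≤ 2 ∧ a.r ≤ 2 ∧ a.t ≤ 1
  | n + 4, a => a.p ≤ s (n + 3) ∧ a.q + a.r + 2 * a.t ≤ 4 * s (n + 2) ∧
      2 * a.q + a.t ≤ 3 * s (n + 2) ∧ 2 * a.r + a.t ≤ 3 * s (n + 2)

/-- The invariant satisfied by every state reached after `n` non-zero digits. -/
structure State.Bound (n : ℕ) (a : State) : Prop where
  pos : 0 < a.f
  le : a.f ≤ s n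
  t_le_q : a.t ≤ a.q
  t_le_r : a.t ≤ a.r
  of_p_eq_zero : a.p = 0 → a.q = 0 ∧ a.r = 0
  neighbour : a.NeighbourBound n

/-- The turns that continue an extremal expansion with `n` non-zero digits: always `ω`, except
that `-ω` replaces it when `n ≡ 2 (mod 3)`, and that both are possible when `n = 3`. -/
def goodFactors (n : ℕ) : Finset Eis :=
  if n = 3 then {w, -w} else if n % 3 = 2 then {-w} else {w}

theorem State.Bound.reset {n : ℕ} {a : State} (h : a.Bound n) : a.reset.Bound n := by
  refine ⟨h.pos, h.le, le_rfl, le_rfl, fun _ => ⟨rfl, rfl⟩, ?_⟩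
  match n with
  | 0 | 1 | 2 | 3 | n + 4 => simp [State.NeighbourBound, State.reset]

/-- The bounds pass to the next digit. The bound `f ≤ s n` can be attained only by continuing an
extremal expansion with a good turn. -/
theorem State.Bound.move {n : ℕ} {a : State} (h : a.Bound n) (τ : Turn) :
    (a.move τ).Bound (n + 1) ∧
      (1 ≤ n → (a.move τ).f = s (n + 1) → a.f = s n ∧ a.p ≠ 0 ∧ τ.factor ∈ goodFactors n) := by
  obtain ⟨h1, h2, h3, h4, h5, h6⟩ := h
  have good : ∀ τ : Turn, (τ = .om ∧ n % 3 ≠ 2) ∨ (τ = .negOm ∧ (n % 3 = 2 ∨ n = 3)) →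
      τ.factor ∈ goodFactors n := by
    rintro τ (⟨rfl, hn⟩ | ⟨rfl, hn⟩) <;> unfold goodFactors
    · split_ifs <;> simp_all [Turn.factor]
    · split_ifs <;> simp_all [Turn.factor]
  suffices H : (a.move τ).Bound (n + 1) ∧ (1 ≤ n → (a.move τ).f = s (n + 1) →
      a.f = s n ∧ a.p ≠ 0 ∧
        ((τ = .om ∧ n % 3 ≠ 2) ∨ (τ = .negOm ∧ (n % 3 = 2 ∨ n = 3)))) from
    ⟨H.1, fun hn hf => ⟨(H.2 hn hf).1, (H.2 hn hf).2.1, good τ (H.2 hn hf).2.2⟩⟩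
  match n, h6 with
  | 0, h6 | 1, h6 | 2, h6 =>
    simp only [State.NeighbourBound, s_zero, s_one, s_two] at h2 h6
    cases τ <;>
    · refine ⟨⟨?_, ?_, ?_, ?_, ?_, ?_⟩, ?_⟩ <;>
        simp [State.NeighbourBound, State.move, State.step, s_zero, s_one, s_two, s_three] <;>
        omega
  | 3, h6 =>
    have e4 : s 4 = 13 := rfl
    simp only [State.NeighbourBound, s_three] at h2 h6
    cases τ <;>
    · refine ⟨⟨?_, ?_, ?_, ?_, ?_, ?_⟩, ?_⟩ <;>
        simp [State.NeighbourBound, State.move, State.step, s_two, s_three, e4] <;>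
        omega
  | n + 4, h6 =>
    obtain ⟨m, hm, hs⟩ := s_four_terms (n + 2)
    simp only [State.NeighbourBound] at h6
    have hmod : (n + 4) % 3 = (n + 2 + 2) % 3 := rfl
    cases τ <;>
    · refine ⟨⟨?_, ?_, ?_, ?_, ?_, ?_⟩, ?_⟩ <;>
        simp [State.NeighbourBound, State.move, State.step, Nat.add_assoc] at hs ⊢ <;>
        omega

theorem Expansion.bound {x u : Eis} {n : ℕ} {a : State} (h : Expansion x n u a) : a.Bound n := by
  induction h with
  | zero hu => exact ⟨by simp, le_rfl, le_rfl, le_rfl, fun _ => ⟨rfl, rfl⟩, rfl⟩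
  | shift _ hv ih => exact ih.reset
  | digit τ _ ih => exact (ih.move τ).1

theorem Expansion.eq_zero {x u : Eis} {n : ℕ} {a : State} (h : Expansion x n u a) (hn : n = 0) :
    x = 0 := by
  induction h with
  | zero => rfl
  | shift _ _ ih => rw [ih hn, mul_zero]
  | digit => omega

/-! ### The extremal numbers -/

/-- Appends a non-zero digit two places below the lowest digit `a.2.2` of the number `a.2.1`. The
new digit is `a.1` times the old one, and the new number is again paired with its lowest digit. -/
def append (a : Eis × (Eis × Eis)) : Eis × Eis := (a.1 * a.2.2 + b ^ 2 * a.2.1, a.1 * a.2.2)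

/-- The numbers with `n` non-zero digits attaining the bound, paired with their lowest digit. -/
def extremal : ℕ → Finset (Eis × Eis)
  | 0 => {0} ×ˢ units
  | n + 1 => (goodFactors n ×ˢ extremal n).image append

theorem goodFactors_subset (n : ℕ) : goodFactors n ⊆ units := by
  unfold goodFactors
  split_ifs <;> decide

theorem snd_mem_units_of_mem_extremal {n : ℕ} {x u : Eis} (h : (x, u) ∈ extremal n) :
    u ∈ units := by
  induction n generalizing x u with
  | zero => exact (Finset.mem_product.1 h).2
  | succ n ih =>
    obtain ⟨⟨a, z, v⟩, hm, he⟩ := Finset.mem_image.1 h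
    obtain ⟨ha, hz⟩ := Finset.mem_product.1 hm
    obtain ⟨rfl, rfl⟩ := Prod.mk.inj he
    exact mul_mem_units _ (goodFactors_subset n ha) _ (ih hz)

theorem exists_of_mem_extremal {n : ℕ} (hn : 1 ≤ n) {x u : Eis} (h : (x, u) ∈ extremal n) :
    ∃ z, x = u + b ^ 2 * z := by
  obtain ⟨n, rfl⟩ := Nat.exists_eq_add_of_le' hn
  obtain ⟨⟨a, z, v⟩, -, he⟩ := Finset.mem_image.1 h
  obtain ⟨rfl, rfl⟩ := Prod.mk.inj he
  exact ⟨z, rfl⟩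

theorem not_b_dvd_of_mem_extremal {n : ℕ} (hn : 1 ≤ n) {x u : Eis} (h : (x, u) ∈ extremal n) :
    ¬ b ∣ x := by
  obtain ⟨z, rfl⟩ := exists_of_mem_extremal hn h
  rw [pow_two, mul_assoc]
  exact not_b_dvd_add (snd_mem_units_of_mem_extremal h) _

theorem fst_injOn_extremal {n : ℕ} (hn : 1 ≤ n) :
    Set.InjOn Prod.fst (extremal n : Set (Eis × Eis)) := by
  rintro ⟨x, u⟩ hx ⟨y, v⟩ hy h
  obtain ⟨z, hz⟩ := exists_of_mem_extremal hn hx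
  obtain ⟨z', hz'⟩ := exists_of_mem_extremal hn hy
  have hxy : x = y := h
  subst hxy
  rw [(digit_unique (snd_mem_units_of_mem_extremal hx) (snd_mem_units_of_mem_extremal hy)
    (hz.symm.trans hz')).1]

theorem card_extremal {n : ℕ} (hn : 4 ≤ n) : (extremal n).card = 12 := by
  induction n, hn using Nat.le_induction with
  | base => decide
  | succ n hn ih =>
    obtain ⟨a, ha⟩ : ∃ a, goodFactors n = {a} := by
      unfold goodFactors
      rw [if_neg (by omega)]
      split_ifs
      exacts [⟨_, rfl⟩, ⟨_, rfl⟩]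
    rw [extremal, Finset.card_image_of_injOn, Finset.card_product, ih, ha, Finset.card_singleton]
    rintro ⟨c, x, u⟩ hx ⟨d, y, v⟩ hy h
    rw [Finset.mem_coe, Finset.mem_product, ha, Finset.mem_singleton] at hx hy
    obtain ⟨rfl, hx⟩ := hx
    obtain ⟨hd, hy⟩ := hy
    dsimp only at hd hx hy
    subst hd
    obtain ⟨h1, h2⟩ := Prod.mk.inj h
    dsimp only at h1 h2
    have hxy : x = y := b_sq_mul_injective (by linear_combination h1 - h2)
    rw [fst_injOn_extremal (by omega) hx hy hxy]

/-- The states on extremal expansions: only the values that decide the next good turn matter. -/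
theorem exists_expansion_of_mem_extremal {n : ℕ} {x u : Eis} (h : (x, u) ∈ extremal n) :
    ∃ a : State, Expansion x n u a ∧ a.f = s n ∧ (n = 0 → a.p = 0) ∧ (1 ≤ n → a.p = s (n - 1)) ∧
      (n % 3 = 2 → a.q = s (n - 2) ∧ a.r = s (n - 2) ∧ a.t = s (n - 2)) ∧
      (n = 3 → a.q + a.r + 2 * a.t = 6) := by
  induction n generalizing x u with
  | zero =>
    obtain ⟨hx, hu⟩ := Finset.mem_product.1 h
    obtain rfl : x = 0 := Finset.mem_singleton.1 hx
    exact ⟨_, .zero hu, by simp [s_zero]⟩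
  | succ n ih =>
    obtain ⟨⟨c, z, v⟩, hm, he⟩ := Finset.mem_image.1 h
    obtain ⟨hc, hz⟩ := Finset.mem_product.1 hm
    obtain ⟨rfl, rfl⟩ := Prod.mk.inj he
    obtain ⟨a, ha, h1, h2, h3, h4, h5⟩ := ih hz
    have hc' : (c = Turn.om.factor ∧ n % 3 ≠ 2) ∨
        (c = Turn.negOm.factor ∧ (n % 3 = 2 ∨ n = 3)) := by
      dsimp only at hc
      unfold goodFactors at hc
      split_ifs at hc <;> simp_all [Turn.factor]
    have hs : n = 0 ∨ n = 1 ∨ n = 2 ∨ n = 3 ∨ 4 ≤ n := by omega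
    rcases hc' with ⟨rfl, hn⟩ | ⟨rfl, hn⟩ <;> refine ⟨_, ha.digit _, ?_⟩ <;>
      simp only [State.move, State.step, Nat.add_sub_cancel]
    · rcases hs with rfl | rfl | rfl | rfl | hn4
      · simp [h1, h2, s_zero, s_one]
      · simp [h1, h3, s_zero, s_one, s_two]
      · omega
      · have e4 : s 4 = 13 := rfl
        simp [h1, h3, s_three, s_two, e4]
      · obtain ⟨k, rfl⟩ := Nat.exists_eq_add_of_le' hn4
        obtain ⟨m, hm, hs⟩ := s_four_terms (k + 2)
        have e : k + 4 + 1 - 2 = k + 3 := by omega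
        have e' : k + 4 - 1 = k + 3 := by omega
        simp only [e, e', Nat.add_assoc, Nat.reduceAdd] at *
        omega
    · rcases hs with rfl | rfl | rfl | rfl | hn4
      · omega
      · omega
      · simp [h1, h4, s_zero, s_two, s_three]
      · have e4 : s 4 = 13 := rfl
        have := h5 rfl
        simp [h1, s_three, e4]
        omega
      · obtain ⟨k, rfl⟩ := Nat.exists_eq_add_of_le' hn4
        obtain ⟨m, hm, hs⟩ := s_four_terms (k + 2)
        have e' : k + 4 - 2 = k + 2 := by omega
        simp only [e', Nat.add_assoc, Nat.reduceAdd] at *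
        omega

theorem Expansion.mem_extremal {x u : Eis} {n : ℕ} {a : State} (h : Expansion x n u a)
    (hf : a.f = s n) (hp : a.p ≠ 0) : (x, u) ∈ extremal n := by
  induction h with
  | zero => exact absurd rfl hp
  | shift => exact absurd rfl hp
  | @digit z u n a τ h ih =>
    rw [extremal, Finset.mem_image]
    rcases Nat.eq_zero_or_pos n with rfl | hn
    · -- the only expansions with one digit are the units
      have hv := mul_mem_units _ (factor_mem_units τ) _ h.hasState.mem_units
      refine ⟨(w, (0, w ^ 2 * (τ.factor * u))), Finset.mem_product.2 ⟨by simp [goodFactors],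
        Finset.mem_product.2 ⟨by simp, w_sq_mul_mem_units hv⟩⟩, ?_⟩
      have e : w * (w ^ 2 * (τ.factor * u)) = τ.factor * u := by
        linear_combination τ.factor * u * w_cube
      simp [append, e, h.eq_zero rfl]
    · obtain ⟨h1, h2, h3⟩ := (h.bound.move τ).2 hn hf
      exact ⟨(τ.factor, (z, u)), Finset.mem_product.2 ⟨h3, ih h1 h2⟩, rfl⟩

theorem Expansion.mem_extremal_of_not_b_dvd {x u : Eis} {n : ℕ} {a : State}
    (h : Expansion x n u a) (hb : ¬ b ∣ x) (hf : a.f = s n) : (x, u) ∈ extremal n := by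
  refine h.mem_extremal hf ?_
  cases h with
  | zero => exact absurd (dvd_zero _) hb
  | shift => exact absurd (dvd_mul_right _ _) hb
  | digit τ h =>
    have := h.bound.pos
    cases τ <;> exact this.ne'

end Eis

namespace Eis



/-! ### Non-adjacent forms -/

/-- `d` is a representation of `x` without two adjacent non-zero digits. -/
def IsTwoNAF (x : Eis) (d : ℕ →₀ Eis) : Prop := IsRep x d ∧ ∀ k, d k = 0 ∨ d (k + 1) = 0

theorem IsTwoNAF.cons_zero {x : Eis} {d : ℕ →₀ Eis} (h : IsTwoNAF x d) :
    IsTwoNAF (b * x) (cons 0 d) := by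
  refine ⟨isRep_cons_iff.2 ⟨Or.inl rfl, h.1.1, by rw [h.1.2, zero_add]⟩, fun k => ?_⟩
  cases k
  · simp
  · simpa using h.2 _

theorem IsTwoNAF.cons {x u : Eis} {d : ℕ →₀ Eis} (h : IsTwoNAF x d) (hu : u ∈ units)
    (h0 : d 0 = 0) : IsTwoNAF (u + b * x) (cons u d) := by
  refine ⟨isRep_cons_iff.2 ⟨Or.inr hu, h.1.1, by rw [h.1.2]⟩, fun k => ?_⟩
  cases k
  · simp [h0]
  · simpa using h.2 _

theorem IsTwoNAF.tail {x : Eis} {d : ℕ →₀ Eis} (h : IsTwoNAF x d) :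
    IsTwoNAF (value (tail d)) (tail d) :=
  ⟨⟨fun k => h.1.1 (k + 1), rfl⟩, fun k => h.2 (k + 1)⟩

theorem IsTwoNAF.eq_add {x : Eis} {d : ℕ →₀ Eis} (h : IsTwoNAF x d) :
    x = d 0 + b * value (Eis.tail d) := by
  rw [← h.1.2, ← value_cons, cons_tail]

theorem IsTwoNAF.zero_mem_units_iff {x : Eis} {d : ℕ →₀ Eis} (h : IsTwoNAF x d) :
    d 0 ∈ units ↔ ¬ b ∣ x := by
  rw [h.eq_add]
  refine ⟨fun hd => not_b_dvd_add hd _, fun hb => (h.1.1 0).resolve_left fun h0 => hb ?_⟩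
  rw [h0, zero_add]
  exact dvd_mul_right _ _

theorem IsTwoNAF.eq_add_sq {x : Eis} {d : ℕ →₀ Eis} (h : IsTwoNAF x d) (hd : d 0 ∈ units) :
    x = d 0 + b ^ 2 * value (Eis.tail (Eis.tail d)) := by
  have h1 : d 1 = 0 := (h.2 0).resolve_left (ne_zero_of_mem_units _ hd)
  have h2 := h.tail.eq_add
  rw [tail_apply, zero_add, h1, zero_add] at h2
  rw [pow_two, mul_assoc, ← h2]
  exact h.eq_add

theorem IsTwoNAF.zero_eq {x : Eis} {d e : ℕ →₀ Eis} (hd : IsTwoNAF x d) (he : IsTwoNAF x e) :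
    d 0 = e 0 := by
  by_cases hb : b ∣ x
  · rw [(hd.1.1 0).resolve_right fun h => hd.zero_mem_units_iff.1 h hb,
      (he.1.1 0).resolve_right fun h => he.zero_mem_units_iff.1 h hb]
  · have h1 := hd.zero_mem_units_iff.2 hb
    have h2 := he.zero_mem_units_iff.2 hb
    exact (digit_unique h1 h2 ((hd.eq_add_sq h1).symm.trans (he.eq_add_sq h2))).1

theorem IsTwoNAF.unique {x : Eis} {d e : ℕ →₀ Eis} (hd : IsTwoNAF x d) (he : IsTwoNAF x e) :
    d = e := by
  ext1 k
  induction k generalizing x d e with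
  | zero => exact hd.zero_eq he
  | succ k ih =>
    have h : value (Eis.tail d) = value (Eis.tail e) := by
      refine b_mul_injective (add_left_cancel (a := d 0) ?_)
      dsimp only
      rw [← hd.eq_add, hd.zero_eq he, ← he.eq_add]
    exact ih hd.tail (h ▸ he.tail)

theorem Expansion.exists_isTwoNAF {x u : Eis} {n : ℕ} {a : State} (h : Expansion x n u a) :
    ∃ d, IsTwoNAF x d ∧ d.support.card = n := by
  induction h with
  | zero => exact ⟨0, ⟨⟨by simp, by simp⟩, by simp⟩, by simp⟩
  | shift _ _ ih =>
    obtain ⟨d, hd, hn⟩ := ih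
    exact ⟨_, hd.cons_zero, by rw [card_support_cons_zero, hn]⟩
  | digit τ h ih =>
    obtain ⟨d, hd, hn⟩ := ih
    have hv := mul_mem_units _ (factor_mem_units τ) _ h.hasState.mem_units
    refine ⟨_, pow_two b ▸ mul_assoc b b _ ▸ hd.cons_zero.cons hv (by simp), ?_⟩
    rw [card_support_cons (ne_zero_of_mem_units _ hv), card_support_cons_zero, hn]

/-- The weight of the 2-NAF is the number of digits of the expansion. -/
theorem IsTwoNAF.exists_expansion {x : Eis} {d : ℕ →₀ Eis} (h : IsTwoNAF x d) :
    ∃ u a, Expansion x d.support.card u a := by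
  obtain ⟨n, u, a, hx⟩ := Eis.exists_expansion x
  obtain ⟨e, he, rfl⟩ := hx.exists_isTwoNAF
  rw [h.unique he]
  exact ⟨u, a, hx⟩

/-! ### Embedding into the complex numbers -/

theorem omega_sq : ω ^ 2 = -1 - ω := by
  have h : IsPrimitiveRoot ω 3 := by
    have h := Complex.isPrimitiveRoot_exp 3 (by norm_num)
    rwa [Nat.cast_ofNat] at h
  have h1 : ω - 1 ≠ 0 := sub_ne_zero.2 (h.ne_one (by norm_num))
  have h3 := h.pow_eq_one
  apply mul_left_cancel₀ h1
  linear_combination h3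

/-- The embedding of the Eisenstein integers into `ℂ`. -/
noncomputable def toComplex : Eis →ₐ[ℤ] ℂ :=
  QuadraticAlgebra.lift ⟨ω, by simp only [zsmul_eq_mul]; push_cast; linear_combination omega_sq⟩

theorem toComplex_apply (x : Eis) : toComplex x = x.re + x.im * ω := by
  simp [toComplex, QuadraticAlgebra.lift]

theorem toComplex_w : toComplex w = ω := by simp [toComplex_apply]

theorem toComplex_b : toComplex b = β := by simp [toComplex_apply, β]; ring

theorem toComplex_injective : Function.Injective toComplex := by
  refine (injective_iff_map_eq_zero _).2 fun x hx => ?_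
  rw [toComplex_apply] at hx
  have h : ((x.re ^ 2 - x.re * x.im + x.im ^ 2 : ℤ) : ℂ) = 0 := by
    push_cast
    linear_combination (x.re - x.im - x.im * ω : ℂ) * hx + (x.im : ℂ) ^ 2 * omega_sq
  have h' : x.re ^ 2 - x.re * x.im + x.im ^ 2 = 0 := by exact_mod_cast h
  have h1 : x.re = 0 := by nlinarith [sq_nonneg (x.re - 2 * x.im), sq_nonneg x.re]
  have h2 : x.im = 0 := by nlinarith [sq_nonneg (2 * x.re - x.im), sq_nonneg x.im]
  exact QuadraticAlgebra.ext h1 h2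

theorem mem_eisensteinIntegers_iff {z : ℂ} :
    z ∈ eisensteinIntegers ↔ ∃ x, toComplex x = z := by
  constructor
  · intro hz
    have : eisensteinIntegers ≤ toComplex.range :=
      Algebra.adjoin_le (Set.singleton_subset_iff.2 ⟨w, toComplex_w⟩)
    exact this hz
  · rintro ⟨x, rfl⟩
    rw [toComplex_apply]
    exact add_mem (intCast_mem _ _)
      (mul_mem (intCast_mem _ _) (Algebra.self_mem_adjoin_singleton ℤ ω))

theorem mem_digits_iff {z : ℂ} : z ∈ digits ↔ ∃ x, (x = 0 ∨ x ∈ units) ∧ toComplex x = z := by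
  have h : ∀ x : Eis, (x = 0 ∨ x ∈ units) ↔
      x = 0 ∨ x = 1 ∨ x = -1 ∨ x = w ∨ x = -w ∨ x = w ^ 2 ∨ x = -w ^ 2 := by
    intro x
    rw [show units = {1, -1, w, -w, w ^ 2, -w ^ 2} by decide]
    simp
  simp only [h, digits, Set.mem_insert_iff, Set.mem_singleton_iff]
  constructor
  · rintro (rfl | rfl | rfl | rfl | rfl | rfl | rfl)
    exacts [⟨0, by simp⟩, ⟨1, by simp⟩, ⟨-1, by simp⟩, ⟨w, by simp [toComplex_w]⟩,
      ⟨-w, by simp [toComplex_w]⟩, ⟨w ^ 2, by simp [toComplex_w]⟩, ⟨-w ^ 2, by simp [toComplex_w]⟩]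
  · rintro ⟨x, rfl | rfl | rfl | rfl | rfl | rfl | rfl, rfl⟩ <;> simp [toComplex_w]

/-- The digit string in `ℂ` with the given digits in `Eis`. -/
noncomputable def embed (d : ℕ →₀ Eis) : ℕ →₀ ℂ := d.mapRange toComplex (map_zero _)

@[simp] theorem embed_apply (d : ℕ →₀ Eis) (k : ℕ) : embed d k = toComplex (d k) := rfl

theorem embed_injective : Function.Injective embed :=
  Finsupp.mapRange_injective _ (map_zero _) toComplex_injective

theorem weight_embed (d : ℕ →₀ Eis) : weight (embed d) = d.support.card := by
  rw [weight, embed, Finsupp.support_mapRange_of_injective _ _ toComplex_injective]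

theorem embed_apply_eq_zero {d : ℕ →₀ Eis} {k : ℕ} : embed d k = 0 ↔ d k = 0 := by
  rw [embed_apply, map_eq_zero_iff _ toComplex_injective]

theorem sum_embed (d : ℕ →₀ Eis) :
    (embed d).sum (fun k a => a * β ^ k) = toComplex (value d) := by
  rw [embed, Finsupp.sum_mapRange_index (by simp), value, Finsupp.sum, Finsupp.sum, map_sum]
  simp [toComplex_b]

theorem isRepresentation_embed {x : Eis} {d : ℕ →₀ Eis} :
    IsRepresentation (toComplex x) (embed d) ↔ IsRep x d := by
  rw [IsRepresentation, IsRep, sum_embed, toComplex_injective.eq_iff]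
  refine and_congr_left fun _ => forall_congr' fun k => ?_
  rw [mem_digits_iff]
  constructor
  · rintro ⟨y, hy, h⟩
    rwa [← toComplex_injective h]
  · exact fun h => ⟨_, h, rfl⟩

theorem IsRepresentation.exists_embed {z : ℂ} {d : ℕ →₀ ℂ} (h : IsRepresentation z d) :
    ∃ e, embed e = d := by
  have h0 : Function.invFun toComplex 0 = 0 :=
    toComplex_injective (by rw [Function.invFun_eq ⟨0, map_zero _⟩, map_zero])
  refine ⟨d.mapRange (Function.invFun toComplex) h0, ?_⟩
  ext1 k
  obtain ⟨y, -, hy⟩ := mem_digits_iff.1 (h.1 k)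
  rw [embed_apply, Finsupp.mapRange_apply]
  exact Function.invFun_eq ⟨y, hy⟩

theorem isNAF_embed {x : Eis} {d : ℕ →₀ Eis} :
    IsNAF 2 (toComplex x) (embed d) ↔ IsTwoNAF x d := by
  rw [IsNAF, IsTwoNAF, isRepresentation_embed]
  refine and_congr_right fun _ => ?_
  simp only [embed_apply_eq_zero]
  constructor
  · exact fun h k => h k (k + 1) (by omega) (by omega)
  · intro h i j hij hj
    obtain rfl : j = i + 1 := by omega
    exact h i

/-- The optimal representations are those counted by the field `f` of the state: there is one, and
no smaller weight occurs. -/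
theorem Expansion.encard_optimalRepresentations {x u : Eis} {n : ℕ} {a : State}
    (h : Expansion x n u a) : (optimalRepresentations (toComplex x)).encard = a.f := by
  have hs := h.hasState
  have hmin : ∀ d, IsRep x d → n ≤ d.support.card := by
    intro d hd
    by_contra hlt
    have h0 := hs.below d.support.card (by omega)
    rw [repCount, Set.encard_eq_zero] at h0
    exact Set.eq_empty_iff_forall_notMem.1 h0 d ⟨hd, rfl⟩
  obtain ⟨e, he, hen⟩ := h.exists_isTwoNAF
  have himage : optimalRepresentations (toComplex x) = embed '' repSet x n := by
    ext d
    constructor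
    · rintro ⟨hd, hopt⟩
      obtain ⟨d, rfl⟩ := IsRepresentation.exists_embed hd
      have h1 := hopt _ (isRepresentation_embed.2 he.1)
      rw [weight_embed, weight_embed, hen] at h1
      have hd' := isRepresentation_embed.1 hd
      exact ⟨d, ⟨hd', by exact_mod_cast h1.antisymm (hmin d hd')⟩, rfl⟩
    · rintro ⟨d, ⟨hd, hdn⟩, rfl⟩
      refine ⟨isRepresentation_embed.2 hd, fun d' hd' => ?_⟩
      obtain ⟨d', rfl⟩ := IsRepresentation.exists_embed hd'
      rw [weight_embed, weight_embed, Nat.cast_injective hdn]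
      exact hmin d' (isRepresentation_embed.1 hd')
  rw [himage, embed_injective.encard_image]
  exact hs.count

theorem exists_eq_beta_mul_iff {x : Eis} :
    (∃ y ∈ eisensteinIntegers, toComplex x = β * y) ↔ b ∣ x := by
  constructor
  · rintro ⟨y, hy, h⟩
    obtain ⟨y, rfl⟩ := mem_eisensteinIntegers_iff.1 hy
    rw [← toComplex_b, ← map_mul] at h
    exact ⟨y, toComplex_injective h⟩
  · rintro ⟨y, rfl⟩
    exact ⟨_, mem_eisensteinIntegers_iff.2 ⟨y, rfl⟩, by rw [map_mul, toComplex_b]⟩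

end Eis

end EisensteinNAF

open EisensteinNAF EisensteinNAF.Eis in
theorem mainTheorem2 :
    (∀ x ∈ EisensteinNAF.eisensteinIntegers, ∃! d : ℕ →₀ ℂ, EisensteinNAF.IsNAF 2 x d) ∧
    (∀ (N : ℕ), ∀ x ∈ EisensteinNAF.eisensteinIntegers, ∀ d : ℕ →₀ ℂ,
      EisensteinNAF.IsNAF 2 x d → EisensteinNAF.weight d = N →
        (EisensteinNAF.optimalRepresentations x).encard ≤ (EisensteinNAF.s N : ℕ∞)) ∧
    (∀ N : ℕ, 4 ≤ N →
      {x : ℂ | x ∈ EisensteinNAF.eisensteinIntegers ∧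
        (¬ ∃ y ∈ EisensteinNAF.eisensteinIntegers, x = EisensteinNAF.β * y) ∧
        (∃ d : ℕ →₀ ℂ, EisensteinNAF.IsNAF 2 x d ∧ EisensteinNAF.weight d = N) ∧
        (EisensteinNAF.optimalRepresentations x).encard = (EisensteinNAF.s N : ℕ∞)}.encard
        = 12) := by
  refine ⟨fun x hx => ?_, fun N x hx d hd hN => ?_, fun N hN => ?_⟩
  · obtain ⟨x, rfl⟩ := mem_eisensteinIntegers_iff.1 hx
    obtain ⟨n, u, a, h⟩ := exists_expansion x
    obtain ⟨d, hd, -⟩ := h.exists_isTwoNAF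
    refine ⟨embed d, isNAF_embed.2 hd, fun e he => ?_⟩
    obtain ⟨e, rfl⟩ := IsRepresentation.exists_embed he.1
    rw [hd.unique (isNAF_embed.1 he)]
  · obtain ⟨x, rfl⟩ := mem_eisensteinIntegers_iff.1 hx
    obtain ⟨d, rfl⟩ := IsRepresentation.exists_embed hd.1
    obtain ⟨u, a, h⟩ := (isNAF_embed.1 hd).exists_expansion
    rw [← hN, weight_embed, h.encard_optimalRepresentations]
    exact_mod_cast h.bound.le
  · have hset : {x : ℂ | x ∈ eisensteinIntegers ∧ (¬ ∃ y ∈ eisensteinIntegers, x = β * y) ∧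
        (∃ d : ℕ →₀ ℂ, IsNAF 2 x d ∧ weight d = N) ∧
        (optimalRepresentations x).encard = (s N : ℕ∞)} =
        toComplex '' (Prod.fst '' (extremal N : Set (Eis × Eis))) := by
      ext z
      constructor
      · rintro ⟨hz, hb, ⟨d, hd, rfl⟩, hc⟩
        obtain ⟨x, rfl⟩ := mem_eisensteinIntegers_iff.1 hz
        obtain ⟨d, rfl⟩ := IsRepresentation.exists_embed hd.1
        obtain ⟨u, a, h⟩ := (isNAF_embed.1 hd).exists_expansion
        rw [h.encard_optimalRepresentations, weight_embed] at hc
        rw [weight_embed]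
        refine ⟨x, ⟨(x, u), ?_, rfl⟩, rfl⟩
        exact h.mem_extremal_of_not_b_dvd (mt exists_eq_beta_mul_iff.2 hb) (by exact_mod_cast hc)
      · rintro ⟨_, ⟨⟨x, u⟩, hx, rfl⟩, rfl⟩
        obtain ⟨a, h, hf, -⟩ := exists_expansion_of_mem_extremal hx
        obtain ⟨d, hd, hn⟩ := h.exists_isTwoNAF
        refine ⟨mem_eisensteinIntegers_iff.2 ⟨x, rfl⟩,
          mt exists_eq_beta_mul_iff.1 (not_b_dvd_of_mem_extremal (by omega) hx),
          ⟨embed d, isNAF_embed.2 hd, by rw [weight_embed, hn]⟩, ?_⟩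
        rw [h.encard_optimalRepresentations, hf]
    rw [hset, toComplex_injective.encard_image, (fst_injOn_extremal (by omega)).encard_image,
      Set.encard_coe_eq_coe_finsetCard, card_extremal hN]
    rfl
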